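/- Let $\mathbb{R}_3$ be the real Clifford algebra generated by $e_1,e_2,e_3$ with $e_j^2=-1$ and $e_ie_j=-e_je_i$ for $i\neq j$, and let $\lambda\mapsto\bar\lambda$ be its real-linear anti-automorphism with $\overline{e_j}=-e_j$. For an integer $k\ge 0$ let $\mathcal{M}(k)$ be the right $\mathbb{R}_3$-module of all $\mathbb{R}_3$-valued homogeneous polynomials $P$ of degree $k$ on $\mathbb{R}^3$ that are left monogenic, i.e. $\sum_{j=1}^3 e_j\,\partial_{x_j}P=0$. An orthonormal basis of $\mathcal{M}(k)$ is a finite family $Y^1,\dots,Y^d$ that spans $\mathcal{M}(k)$ over $\mathbb{R}_3$ and satisfies $\int_{S^2}\overline{Y^i(\omega)}\,Y^j(\omega)\,d\sigma(\omega)=\delta_{ij}$, where $\sigma$ is the surface measure of $S^2$ normalised to total mass one. The reproducing kernel of $\mathcal{M}(k)$ is $$K_k(x,y)=\sum_{l=1}^{d}Y^l(x)\,\overline{Y^l(y)},$$ and for $x,y\in S^2$ its closed form is $$(k+1)\,C_k^{1/2}(\langle x,y\rangle)+(x\wedge y)\,C_{k-1}^{3/2}(\langle x,y\rangle),\qquad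 x\wedge y=\sum_{i<j}e_ie_j\,(x_iy_j-x_jy_i),$$ where $\langle x,y\rangle=\sum_j x_jy_j$, $C_n^\mu$ are the Gegenbauer polynomials and $C_{-1}^{3/2}=0$. For $\eta=(\eta_1,\dots,\eta_{k+1})\in(S^2)^{k+1}$ let $G(\eta)$ be the $(k+1)\times(k+1)$ matrix over $\mathbb{R}_3$ with entries $G(\eta)_{ij}=K_k(\eta_i,\eta_j)$. **Theorem.** For every $k\ge 0$ and for almost every $\eta\in(S^2)^{k+1}$, with respect to the product of the surface measures, the matrix $G(\eta)$ is invertible. This holds for $K_k$ built from any orthonormal basis of $\mathcal{M}(k)$, and for $K_k$ given by the closed form. -/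

import Mathlib

open MeasureTheory

/-- Euclidean three-space. -/
abbrev E3 : Type := EuclideanSpace ℝ (Fin 3)

/-- The unit sphere of Euclidean three-space. -/
abbrev S2 : Type := Metric.sphere (0 : E3) 1

/-- The quadratic form `v ↦ -(v₀² + v₁² + v₂²)`. -/
noncomputable abbrev negSq : QuadraticForm ℝ (Fin 3 → ℝ) :=
  QuadraticMap.weightedSumSquares ℝ (fun _ : Fin 3 => (-1 : ℝ))

/-- The eight-dimensional real Clifford algebra with `e j ^ 2 = -1` and `e i * e j = -(e j * e i)`
for `i ≠ j`. Its `star` is the Hermitian (Clifford) conjugation: the real-linear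
anti-automorphism that sends `e j` to `-e j`. -/
abbrev Cl3 : Type := CliffordAlgebra negSq

/-- The generators of the Clifford algebra. -/
noncomputable def e (j : Fin 3) : Cl3 := CliffordAlgebra.ι negSq (Pi.single j 1)

theorem e_sq (j : Fin 3) : e j * e j = -1 := by
  simp [e, CliffordAlgebra.ι_sq_scalar, QuadraticMap.weightedSumSquares_apply,
    Pi.single_apply]

theorem e_anticomm {i j : Fin 3} (h : i ≠ j) : e i * e j = -(e j * e i) := by
  have := CliffordAlgebra.ι_mul_ι_add_swap (Q := negSq)
    (Pi.single i (1 : ℝ)) (Pi.single j 1)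
  rw [eq_neg_iff_add_eq_zero, e, e, this]
  have h0 : QuadraticMap.polar negSq (Pi.single i (1 : ℝ)) (Pi.single j 1) = 0 := by
    fin_cases i <;> fin_cases j <;>
      simp_all [QuadraticMap.polar, QuadraticMap.weightedSumSquares_apply, Fin.sum_univ_three,
        Pi.single_apply]
  rw [h0, map_zero]

theorem star_e (j : Fin 3) : star (e j) = -e j := by
  simp [e, CliffordAlgebra.star_def]

/-- Polynomials in three real variables with coefficients in the Clifford algebra: `P α` is the
coefficient of the monomial `x ^ α`. The Clifford algebra acts on them on both sides; the right
action is the action of `Cl3ᵐᵒᵖ`. -/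
abbrev CliffordPoly : Type := (Fin 3 →₀ ℕ) →₀ Cl3

namespace CliffordPoly

/-- The value of a Clifford polynomial at a point. -/
noncomputable def eval (x : E3) (P : CliffordPoly) : Cl3 :=
  P.sum fun α c => (α.prod fun i n => x i ^ n) • c

/-- The partial derivative in the `j`-th variable, `x ^ α c ↦ α_j x ^ (α - 1_j) c`. -/
noncomputable def pderiv (j : Fin 3) : CliffordPoly →ₗ[Cl3ᵐᵒᵖ] CliffordPoly :=
  Finsupp.lsum ℕ fun α => (α j) • Finsupp.lsingle (α - Finsupp.single j 1)

/-- The Dirac operator `∑ j, e j ∂_j`, acting from the left. -/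
noncomputable def dirac : CliffordPoly →ₗ[Cl3ᵐᵒᵖ] CliffordPoly :=
  ∑ j : Fin 3, e j • pderiv j

end CliffordPoly

/-- The right Clifford module of the left monogenic homogeneous polynomials of degree `k`
(the solid inner spherical monogenics of order `k`). -/
noncomputable def sphericalMonogenics (k : ℕ) : Submodule Cl3ᵐᵒᵖ CliffordPoly :=
  Finsupp.supported Cl3 Cl3ᵐᵒᵖ {α : Fin 3 →₀ ℕ | α.degree = k} ⊓ LinearMap.ker CliffordPoly.dirac

/-- The surface measure of the unit sphere. -/
noncomputable abbrev surfaceMeasure : Measure S2 := (volume : Measure E3).toSphere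

/-- `Y` is an orthonormal basis of the right Clifford module of spherical monogenics of order `k`:
it spans the module, and `∫ star (Y i) * Y j = δ i j`, with the integral over the sphere with
respect to the normalised surface measure. The integral of the Clifford-valued function is
expressed through all real-linear functionals on the (finite-dimensional) Clifford algebra. -/
structure IsMonogenicONB (k : ℕ) {d : ℕ} (Y : Fin d → CliffordPoly) : Prop where
  span_eq : Submodule.span Cl3ᵐᵒᵖ (Set.range Y) = sphericalMonogenics k
  orthonormal : ∀ (i j : Fin d) (φ : Cl3 →ₗ[ℝ] ℝ),
    ⨍ ω, φ (star ((Y i).eval (ω : E3)) * (Y j).eval (ω : E3)) ∂surfaceMeasure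
      = φ (if i = j then 1 else 0)

/-- The kernel `K(x, y) = ∑ l, Y l (x) * star (Y l (y))`; for an orthonormal basis `Y` of the
spherical monogenics of order `k` it is their reproducing kernel. -/
noncomputable def monogenicKernel {d : ℕ} (Y : Fin d → CliffordPoly) (x y : E3) : Cl3 :=
  ∑ l, (Y l).eval x * star ((Y l).eval y)

/-- The Gegenbauer polynomial `C_n^μ(t)`. -/
noncomputable def gegenbauer (μ : ℝ) (n : ℕ) (t : ℝ) : ℝ :=
  ∑ j ∈ Finset.range (n / 2 + 1),
    (-1) ^ j * (ascPochhammer ℝ (n - j)).eval μ / (j.factorial * (n - 2 * j).factorial)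
      * (2 * t) ^ (n - 2 * j)

/-- The bivector `x ∧ y = ∑_{i < j} e i e j (x i y j - x j y i)`. -/
noncomputable def wedge (x y : E3) : Cl3 :=
  ∑ i : Fin 3, ∑ j ∈ Finset.Ioi i, (x i * y j - x j * y i) • (e i * e j)

/-- The closed form `(k+1) C_k^{1/2}(⟨x,y⟩) + (x ∧ y) C_{k-1}^{3/2}(⟨x,y⟩)` of the reproducing kernel
for unit vectors `x`, `y`, where `C_{-1}^{3/2} = 0`. -/
noncomputable def closedFormKernel (k : ℕ) (x y : E3) : Cl3 :=
  algebraMap ℝ Cl3 ((k + 1) * gegenbauer (1 / 2) k (inner ℝ x y))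
    + (if k = 0 then 0 else gegenbauer (3 / 2) (k - 1) (inner ℝ x y)) • wedge x y

/-- The Gram matrix `G(η) i j = K(η i, η j)` of a Clifford-valued kernel. -/
noncomputable def gramMatrix {n : ℕ} (K : E3 → E3 → Cl3) (η : Fin n → S2) :
    Matrix (Fin n) (Fin n) Cl3 :=
  Matrix.of fun i j => K (η i : E3) (η j : E3)

/-!
The matrix of a kernel at a tuple of points is invertible exactly when its algebra norm over `ℝ` is
nonzero, and this norm is an analytic function of the tuple. As the kernels are homogeneous, it
therefore suffices to find one tuple of points of the space at which the matrix is invertible. The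
points `(0, i, 1)` of the plane `x 0 = 0` will do.

If `Y` spans the spherical monogenics, the matrix is `V * Vᴴ` with `V` the matrix of the values of
`Y`. Polynomials on the plane `x 0 = 0` extend to monogenic ones (Cauchy–Kovalevskaya), so an
ordinary Vandermonde matrix shows that `V` has a right inverse. Then `V * Vᴴ` is invertible because
`∑ i, a i * star (a i) = 0` forces `a = 0`: the two representations of the Clifford algebra on the
quaternions turn the left side into a sum of squared norms.

On the plane, with complex coordinates `z` and `u`, the closed form takes values in a copy of the
complex numbers. Factoring the generating function of the Gegenbauer polynomials into powers of
`1 - w X` and `1 - star w X`, where `w = star z * u`, expresses it as a combination of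
`w ^ a * star w ^ (k - a)` with positive coefficients. Hence the matrix is `A * D * Aᴴ` with `A` of
Vandermonde type and `D` positive diagonal, which is positive definite.
-/

section SphereMeasure

variable {V : Type*} [NormedAddCommGroup V] [NormedSpace ℝ V] [FiniteDimensional ℝ V]
  [MeasurableSpace V] [BorelSpace V] (μ : Measure V) [μ.IsAddHaarMeasure]

theorem measurePreserving_smul_toSphere [Nontrivial V] :
    MeasurePreserving (fun p : Metric.sphere (0 : V) 1 × Set.Ioi (0 : ℝ) => (p.2 : ℝ) • (p.1 : V))
      (μ.toSphere.prod (Measure.volumeIoiPow (Module.finrank ℝ V - 1))) μ := by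
  have hval := measurePreserving_subtype_coe (μa := μ) (measurableSet_singleton (0 : V)).compl
  rw [Measure.restrict_eq_self_of_ae_mem (s := {(0 : V)}ᶜ) (Measure.ae_ne μ 0)] at hval
  convert hval.comp (MeasurePreserving.symm (homeomorphUnitSphereProd V).toMeasurableEquiv
    μ.measurePreserving_homeomorphUnitSphereProd) using 1
  exact funext fun p => (homeomorphUnitSphereProd_symm_apply_coe V p).symm

theorem volumeIoiPow_ne_zero (n : ℕ) : Measure.volumeIoiPow n ≠ 0 := fun h => by
  have hIio := Measure.volumeIoiPow_apply_Iio n ⟨1, Set.mem_Ioi.2 one_pos⟩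
  rw [h, Measure.coe_zero, Pi.zero_apply, eq_comm, ENNReal.ofReal_eq_zero, one_pow] at hIio
  exact hIio.not_gt (by positivity)

theorem ae_ne_zero_of_analyticOnNhd_real {g : ℝ → ℝ} (hg : AnalyticOnNhd ℝ g Set.univ) {t₀ : ℝ}
    (h₀ : g t₀ ≠ 0) : ∀ᵐ t, g t ≠ 0 := by
  rw [← Measure.restrict_univ (μ := volume)]
  exact ae_restrict_le_codiscreteWithin .univ (hg.preimage_zero_mem_codiscrete h₀)

theorem ae_volumeIoiPow_of_ae {p : ℝ → Prop} (h : ∀ᵐ t, p t) (n : ℕ) :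
    ∀ᵐ t : Set.Ioi (0 : ℝ) ∂Measure.volumeIoiPow n, p t :=
  (withDensity_absolutelyContinuous _ _).ae_le <|
    (measurePreserving_subtype_coe measurableSet_Ioi).quasiMeasurePreserving.ae
      (ae_restrict_of_ae h)

theorem ae_ne_zero_of_analyticOnNhd {f : V → ℝ} (hf : AnalyticOnNhd ℝ f Set.univ) {x₀ : V}
    (h₀ : f x₀ ≠ 0) : ∀ᵐ x ∂μ, f x ≠ 0 := by
  rcases subsingleton_or_nontrivial V with _ | _
  · exact .of_forall fun x => Subsingleton.elim x₀ x ▸ h₀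
  suffices h : ∀ᵐ x ∂μ, f (x₀ + x) ≠ 0 by
    simpa using (measurePreserving_add_left μ (-x₀)).quasiMeasurePreserving.ae h
  have hcont : Continuous f := continuousOn_univ.mp hf.continuousOn
  have hmeas : MeasurableSet {x | f (x₀ + x) ≠ 0} :=
    (measurableSet_eq_fun (by fun_prop) measurable_const).compl
  have hpolar := measurePreserving_smul_toSphere μ
  rw [← hpolar.map_eq, ae_map_iff hpolar.aemeasurable hmeas]
  refine (Measure.ae_prod_iff_ae_ae (hpolar.measurable hmeas)).2 ?_
  refine .of_forall fun v => ae_volumeIoiPow_of_ae (p := fun t => f (x₀ + t • (v : V)) ≠ 0) ?_ _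
  exact ae_ne_zero_of_analyticOnNhd_real (t₀ := 0)
    (fun t _ => AnalyticAt.fun_comp (hf _ trivial) (by fun_prop)) (by simpa using h₀)

variable {ι : Type*} [Fintype ι]

theorem ae_pi_toSphere_of_ae [Nontrivial V] {p : (ι → V) → Prop}
    (h : ∀ᵐ x ∂Measure.pi fun _ => μ, p x)
    (hsmul : ∀ (r : ι → ℝ) (x : ι → V), (∀ i, 0 < r i) → p (fun i => r i • x i) → p x) :
    ∀ᵐ η ∂(Measure.pi fun _ : ι => μ.toSphere), p fun i => η i := by
  have hpolar := (measurePreserving_pi _ _ fun _ : ι =>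
    measurePreserving_smul_toSphere μ).comp (MeasurePreserving.symm _
      (measurePreserving_arrowProdEquivProdArrow _ _ ι _ _))
  filter_upwards [Measure.ae_ae_of_ae_prod (hpolar.quasiMeasurePreserving.ae h)] with η hη
  have : NeZero (Measure.pi fun _ : ι => Measure.volumeIoiPow (Module.finrank ℝ V - 1)) := ⟨by
    simp [← Measure.measure_univ_ne_zero, Measure.pi_univ, volumeIoiPow_ne_zero]⟩
  obtain ⟨r, hr⟩ := hη.exists
  exact hsmul (fun i => r i) _ (fun i => (r i).2) hr

end SphereMeasure

section KernelMatrix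

/-- The matrix `(K (x i) (x j))` of a kernel at a tuple of points. -/
def kernelMatrix {ι X A : Type*} (K : X → X → A) (x : ι → X) : Matrix ι ι A :=
  Matrix.of fun i j => K (x i) (x j)

theorem isUnit_kernelMatrix_smul_iff {𝕜 X A ι : Type*} [Field 𝕜] [SMul 𝕜 X] [Ring A] [Algebra 𝕜 A]
    [Fintype ι] [DecidableEq ι] {K : X → X → A} {k : ℕ}
    (hK : ∀ (r s : 𝕜) (x y : X), K (r • x) (s • y) = (r * s) ^ k • K x y)
    {r : ι → 𝕜} (hr : ∀ i, r i ≠ 0) (x : ι → X) :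
    IsUnit (kernelMatrix K fun i => r i • x i) ↔ IsUnit (kernelMatrix K x) := by
  let D : Matrix ι ι A := Matrix.diagonal fun i => algebraMap 𝕜 A (r i ^ k)
  have hD : IsUnit D :=
    (Pi.isUnit_iff.2 fun i => ((hr i).isUnit.pow k).map (algebraMap 𝕜 A)).map
      (Matrix.diagonalRingHom ι A)
  have hfactor : kernelMatrix K (fun i => r i • x i) = D * kernelMatrix K x * D := by
    ext i j
    simp only [D, kernelMatrix, Matrix.of_apply, Matrix.mul_diagonal, Matrix.diagonal_mul, hK,
      ← Algebra.commutes (r j ^ k), ← Algebra.smul_def, smul_smul, mul_pow, mul_comm]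
  rw [hfactor, hD.mul_right_iff, hD.mul_left_iff]

theorem isUnit_iff_algebraNorm_ne_zero {𝕜 A : Type*} [Field 𝕜] [Ring A] [Algebra 𝕜 A]
    [Module.Finite 𝕜 A] {a : A} : IsUnit a ↔ Algebra.norm 𝕜 a ≠ 0 := by
  rw [← isUnit_iff_ne_zero, Algebra.norm_apply, ← LinearMap.isUnit_iff_isUnit_det,
    Algebra.lmul_isUnit_iff]

variable {V W A : Type*} [NormedAddCommGroup V] [NormedSpace ℝ V] [NormedAddCommGroup W]
  [NormedSpace ℝ W] [Ring A] [Algebra ℝ A]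

/-- A function with values in a real algebra is weakly analytic if its composition with every real
linear functional is analytic. For finite-dimensional algebras this is analyticity, and no norm on
the algebra has to be chosen. -/
def WeaklyAnalytic (F : V → A) : Prop :=
  ∀ φ : A →ₗ[ℝ] ℝ, AnalyticOnNhd ℝ (fun v => φ (F v)) Set.univ

theorem WeaklyAnalytic.smul_const {f : V → ℝ} (hf : AnalyticOnNhd ℝ f Set.univ) (c : A) :
    WeaklyAnalytic fun v => f v • c := fun φ => by
  simpa only [map_smul, smul_eq_mul] using hf.mul analyticOnNhd_const

theorem WeaklyAnalytic.add {F G : V → A} (hF : WeaklyAnalytic F) (hG : WeaklyAnalytic G) :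
    WeaklyAnalytic fun v => F v + G v := fun φ => by
  simp only [map_add]
  exact (hF φ).add (hG φ)

theorem WeaklyAnalytic.sum {σ : Type*} {s : Finset σ} {F : σ → V → A}
    (hF : ∀ i ∈ s, WeaklyAnalytic (F i)) : WeaklyAnalytic fun v => ∑ i ∈ s, F i v := fun φ => by
  simpa only [map_sum] using s.analyticOnNhd_fun_sum fun i hi => hF i hi φ

theorem WeaklyAnalytic.comp_linear {F : W → A} (hF : WeaklyAnalytic F) (g : V →L[ℝ] W) :
    WeaklyAnalytic fun v => F (g v) := fun φ _ _ =>
  (hF φ _ trivial).fun_comp (g.analyticAt _)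

theorem WeaklyAnalytic.matrix {ι : Type*} [Fintype ι] [DecidableEq ι] {F : V → Matrix ι ι A}
    (hF : ∀ i j, WeaklyAnalytic fun v => F v i j) : WeaklyAnalytic F := fun φ => by
  have hsum (v : V) : φ (F v) = ∑ i, ∑ j, (φ ∘ₗ Matrix.singleLinearMap ℝ i j) (F v i j) := by
    conv_lhs => rw [Matrix.matrix_eq_sum_single (F v)]
    simp only [map_sum, LinearMap.comp_apply, Matrix.singleLinearMap_apply]
  simpa only [hsum] using Finset.univ.analyticOnNhd_fun_sum fun i _ =>
    Finset.univ.analyticOnNhd_fun_sum fun j _ => hF i j _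

theorem WeaklyAnalytic.algebraNorm [Module.Finite ℝ A] {F : V → A} (hF : WeaklyAnalytic F) :
    AnalyticOnNhd ℝ (fun v => Algebra.norm ℝ (F v)) Set.univ := by
  let b := Module.finBasis ℝ A
  simp only [Algebra.norm_eq_matrix_det b, Matrix.det_apply', Algebra.leftMulMatrix_eq_repr_mul]
  exact Finset.univ.analyticOnNhd_fun_sum fun σ _ => analyticOnNhd_const.mul <|
    Finset.univ.analyticOnNhd_fun_prod fun i _ =>
      hF (b.coord (σ i) ∘ₗ LinearMap.mulRight ℝ (b i))

theorem ae_isUnit_kernelMatrix [FiniteDimensional ℝ V] [Nontrivial V] [MeasurableSpace V]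
    [BorelSpace V] (μ : Measure V) [μ.IsAddHaarMeasure] [Module.Finite ℝ A] {ι : Type*} [Fintype ι]
    [DecidableEq ι] {K : V → V → A} {k : ℕ} (hK : WeaklyAnalytic fun p : V × V => K p.1 p.2)
    (hsmul : ∀ (r s : ℝ) (x y : V), K (r • x) (s • y) = (r * s) ^ k • K x y)
    {x₀ : ι → V} (hx₀ : IsUnit (kernelMatrix K x₀)) :
    ∀ᵐ η ∂(Measure.pi fun _ : ι => μ.toSphere), IsUnit (kernelMatrix K fun i => (η i : V)) := by
  have hanalytic : WeaklyAnalytic (kernelMatrix K : (ι → V) → Matrix ι ι A) :=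
    .matrix fun i j => hK.comp_linear
      ((ContinuousLinearMap.proj i).prod (ContinuousLinearMap.proj j : (ι → V) →L[ℝ] V))
  refine ae_pi_toSphere_of_ae μ (p := fun x => IsUnit (kernelMatrix K x)) ?_
    fun r x hr => (isUnit_kernelMatrix_smul_iff hsmul (fun i => (hr i).ne') x).1
  simp only [isUnit_iff_algebraNorm_ne_zero (𝕜 := ℝ)] at hx₀ ⊢
  exact ae_ne_zero_of_analyticOnNhd _ hanalytic.algebraNorm hx₀

end KernelMatrix

section Definite

theorem isUnit_mul_conjTranspose {A m n : Type*} [Ring A] [StarRing A] [Fintype m] [Fintype n]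
    [DecidableEq m] [IsArtinianRing (Matrix m m A)]
    (hdef : ∀ a : n → A, ∑ j, a j * star (a j) = 0 → a = 0)
    {V : Matrix m n A} {W : Matrix n m A} (h : V * W = 1) : IsUnit (V * V.conjTranspose) := by
  rw [IsArtinianRing.isUnit_iff_isRightRegular, isRightRegular_iff_left_eq_zero_of_mul]
  intro X hX
  have hXV : X * V = 0 := by
    have h1 : (X * V) * (X * V).conjTranspose = 0 := by
      rw [Matrix.conjTranspose_mul, Matrix.mul_assoc, ← Matrix.mul_assoc V, ← Matrix.mul_assoc X,
        hX, Matrix.zero_mul]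
    exact funext fun i => hdef _ (congrFun (congrFun h1 i) i)
  rw [← Matrix.mul_one X, ← h, ← Matrix.mul_assoc, hXV, Matrix.zero_mul]

end Definite

section CliffordAlgebra

theorem e_mul_e_mul (j : Fin 3) (x : Cl3) : e j * (e j * x) = -x := by
  rw [← mul_assoc, e_sq, neg_one_mul]

theorem e_mul_e_mul_of_ne {i j : Fin 3} (h : i ≠ j) (x : Cl3) :
    e i * (e j * x) = -(e j * (e i * x)) := by
  rw [← mul_assoc, e_anticomm h, neg_mul, mul_assoc]

theorem ι_eq_sum_smul_e (m : Fin 3 → ℝ) : CliffordAlgebra.ι negSq m = ∑ j, m j • e j := by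
  conv_lhs => rw [pi_eq_sum_univ' m]
  simp only [map_sum, map_smul, e]

/-- The pseudoscalar `e 0 * e 1 * e 2`, a central square root of `1`. -/
noncomputable def pseudoscalar : Cl3 := e 0 * (e 1 * e 2)

theorem pseudoscalar_mul_self : pseudoscalar * pseudoscalar = 1 := by
  simp only [pseudoscalar, mul_assoc, e_mul_e_mul_of_ne (show (2 : Fin 3) ≠ 0 by decide),
    e_mul_e_mul_of_ne (show (1 : Fin 3) ≠ 0 by decide), mul_neg, neg_neg, e_mul_e_mul,
    e_mul_e_mul_of_ne (show (2 : Fin 3) ≠ 1 by decide), e_sq]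

theorem commute_pseudoscalar (a : Cl3) : Commute pseudoscalar a := by
  have he (j : Fin 3) : Commute pseudoscalar (e j) := by
    have h10 := e_mul_e_mul_of_ne (show (1 : Fin 3) ≠ 0 by decide)
    have h20 := e_mul_e_mul_of_ne (show (2 : Fin 3) ≠ 0 by decide)
    have h21 := e_mul_e_mul_of_ne (show (2 : Fin 3) ≠ 1 by decide)
    fin_cases j <;>
      simp [Commute, SemiconjBy, pseudoscalar, mul_assoc, h10, h20, h21, e_mul_e_mul, e_sq,
        e_anticomm (show (2 : Fin 3) ≠ 0 by decide), e_anticomm (show (2 : Fin 3) ≠ 1 by decide)]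
  induction a using CliffordAlgebra.induction with
  | algebraMap r => exact (Algebra.commutes r _).symm
  | ι m =>
    rw [ι_eq_sum_smul_e]
    exact Commute.sum_right _ _ _ fun j _ => (he j).smul_right _
  | mul a b ha hb => exact ha.mul_right hb
  | add a b ha hb => exact ha.add_right hb

/-- The bivectors `e 1 * e 2`, `e 2 * e 0`, `e 0 * e 1` multiply like the quaternion units, so the
quaternions embed into the Clifford algebra as its even part. -/
noncomputable def evenQuaternion : Quaternion ℝ →ₐ[ℝ] Cl3 :=
  QuaternionAlgebra.lift
    { i := e 1 * e 2
      j := e 2 * e 0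
      k := e 0 * e 1
      i_mul_i := by
        simp only [mul_assoc, e_mul_e_mul_of_ne (show (2 : Fin 3) ≠ 1 by decide), e_sq,
          mul_neg, neg_neg, mul_one, neg_one_smul, zero_smul, add_zero]
      j_mul_j := by
        simp only [mul_assoc, e_mul_e_mul_of_ne (show (0 : Fin 3) ≠ 2 by decide), e_sq,
          mul_neg, neg_neg, mul_one, neg_one_smul]
      i_mul_j := by
        simp only [mul_assoc, e_mul_e_mul, mul_neg, e_anticomm (show (1 : Fin 3) ≠ 0 by decide),
          neg_neg]
      j_mul_i := by
        simp only [mul_assoc, e_mul_e_mul_of_ne (show (2 : Fin 3) ≠ 0 by decide),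
          e_anticomm (show (1 : Fin 3) ≠ 2 by decide), mul_neg, neg_neg, e_mul_e_mul, zero_smul,
          zero_sub] }

theorem evenQuaternion_apply (p : Quaternion ℝ) :
    evenQuaternion p = algebraMap ℝ Cl3 p.re + p.imI • (e 1 * e 2) + p.imJ • (e 2 * e 0)
      + p.imK • (e 0 * e 1) :=
  rfl

/-- The purely imaginary quaternion with the given imaginary parts. -/
noncomputable def imQuaternion : (Fin 3 → ℝ) →ₗ[ℝ] Quaternion ℝ where
  toFun m := ⟨0, m 0, m 1, m 2⟩
  map_add' _ _ := QuaternionAlgebra.ext (add_zero 0).symm rfl rfl rfl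
  map_smul' r _ := QuaternionAlgebra.ext (mul_zero r).symm rfl rfl rfl

@[simp]
theorem re_imQuaternion (m : Fin 3 → ℝ) : (imQuaternion m).re = 0 := rfl

@[simp]
theorem imI_imQuaternion (m : Fin 3 → ℝ) : (imQuaternion m).imI = m 0 := rfl

@[simp]
theorem imJ_imQuaternion (m : Fin 3 → ℝ) : (imQuaternion m).imJ = m 1 := rfl

@[simp]
theorem imK_imQuaternion (m : Fin 3 → ℝ) : (imQuaternion m).imK = m 2 := rfl

theorem star_imQuaternion (m : Fin 3 → ℝ) : star (imQuaternion m) = -imQuaternion m :=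
  Quaternion.star_eq_neg.2 (re_imQuaternion m)

theorem imQuaternion_mul_self (m : Fin 3 → ℝ) :
    imQuaternion m * imQuaternion m = algebraMap ℝ _ (negSq m) := by
  have hnorm : Quaternion.normSq (imQuaternion m) = -negSq m := by
    rw [Quaternion.normSq_def', QuadraticMap.weightedSumSquares_apply, Fin.sum_univ_three]
    simp only [re_imQuaternion, imI_imQuaternion, imJ_imQuaternion, imK_imQuaternion, smul_eq_mul]
    ring
  rw [← neg_neg (imQuaternion m * imQuaternion m), ← mul_neg, ← star_imQuaternion,
    Quaternion.self_mul_star, hnorm, Quaternion.coe_neg, neg_neg, Quaternion.algebraMap_def]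

theorem ι_eq_pseudoscalar_mul (m : Fin 3 → ℝ) :
    CliffordAlgebra.ι negSq m = -(pseudoscalar * evenQuaternion (imQuaternion m)) := by
  simp only [ι_eq_sum_smul_e, Fin.sum_univ_three, evenQuaternion_apply, re_imQuaternion,
    imI_imQuaternion, imJ_imQuaternion, imK_imQuaternion, pseudoscalar, map_zero, zero_add,
    mul_add, mul_smul_comm, mul_assoc, e_mul_e_mul, e_sq,
    e_mul_e_mul_of_ne (show (2 : Fin 3) ≠ 1 by decide), mul_neg, mul_one, neg_neg,
    e_mul_e_mul_of_ne (show (1 : Fin 3) ≠ 0 by decide),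
    e_mul_e_mul_of_ne (show (2 : Fin 3) ≠ 0 by decide),
    e_anticomm (show (2 : Fin 3) ≠ 0 by decide), e_anticomm (show (2 : Fin 3) ≠ 1 by decide),
    e_anticomm (show (1 : Fin 3) ≠ 0 by decide), smul_neg, neg_add]

theorem exists_eq_evenQuaternion_add (a : Cl3) :
    ∃ p q, a = evenQuaternion p + pseudoscalar * evenQuaternion q := by
  induction a using CliffordAlgebra.left_induction with
  | algebraMap r =>
    exact ⟨algebraMap _ _ r, 0, by rw [AlgHom.commutes, map_zero, mul_zero, add_zero]⟩
  | add a b ha hb =>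
    obtain ⟨p, q, rfl⟩ := ha
    obtain ⟨p', q', rfl⟩ := hb
    exact ⟨p + p', q + q', by simp only [map_add, mul_add]; abel⟩
  | ι_mul a m ha =>
    obtain ⟨p, q, rfl⟩ := ha
    refine ⟨-(imQuaternion m * q), -(imQuaternion m * p), ?_⟩
    have hpull (x y : Cl3) : pseudoscalar * x * (pseudoscalar * y) = x * y := by
      rw [(commute_pseudoscalar x).symm.mul_mul_mul_comm, pseudoscalar_mul_self, one_mul]
    simp only [ι_eq_pseudoscalar_mul, map_neg, map_mul, neg_mul, mul_neg, mul_add, hpull, mul_assoc]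
    abel

/-- For `s = 1` and `s = -1`, the two representations of the Clifford algebra on the quaternions. -/
noncomputable def toQuaternion (s : ℝ) (hs : s * s = 1) : Cl3 →ₐ[ℝ] Quaternion ℝ :=
  CliffordAlgebra.lift negSq ⟨s • imQuaternion, fun m => by
    rw [LinearMap.smul_apply, smul_mul_smul_comm, hs, one_smul, imQuaternion_mul_self]⟩

variable {s : ℝ} (hs : s * s = 1)

theorem toQuaternion_ι (m : Fin 3 → ℝ) :
    toQuaternion s hs (CliffordAlgebra.ι negSq m) = s • imQuaternion m :=
  CliffordAlgebra.lift_ι_apply _ _ _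

theorem toQuaternion_star (a : Cl3) :
    toQuaternion s hs (star a) = star (toQuaternion s hs a) := by
  induction a using CliffordAlgebra.induction with
  | algebraMap r => simp [CliffordAlgebra.star_algebraMap]
  | ι m =>
    rw [CliffordAlgebra.star_ι, map_neg, toQuaternion_ι, Quaternion.star_smul, star_imQuaternion,
      smul_neg]
  | mul a b ha hb => rw [star_mul, map_mul, map_mul, star_mul, ha, hb]
  | add a b ha hb => rw [star_add, map_add, map_add, star_add, ha, hb]

theorem toQuaternion_evenQuaternion (p : Quaternion ℝ) :
    toQuaternion s hs (evenQuaternion p) = p := by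
  have hjk (j k : Fin 3) : toQuaternion s hs (e j * e k) =
      imQuaternion (Pi.single j 1) * imQuaternion (Pi.single k 1) := by
    rw [e, e, map_mul, toQuaternion_ι, toQuaternion_ι, smul_mul_smul_comm, hs, one_smul]
  rw [evenQuaternion_apply]
  simp only [map_add, map_smul, AlgHom.commutes, hjk]
  ext <;> simp

theorem toQuaternion_pseudoscalar : toQuaternion s hs pseudoscalar = algebraMap ℝ _ (-s) := by
  have hunits : imQuaternion (Pi.single 0 1) * (imQuaternion (Pi.single 1 1) *
      imQuaternion (Pi.single 2 1)) = -1 := by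
    ext <;> simp <;> rfl
  simp only [pseudoscalar, e, map_mul, toQuaternion_ι, smul_mul_smul_comm, hs, mul_one, hunits,
    smul_neg, map_neg, Algebra.algebraMap_eq_smul_one]

theorem eq_zero_of_toQuaternion_eq_zero {a : Cl3}
    (h : ∀ (s : ℝ) (hs : s * s = 1), toQuaternion s hs a = 0) : a = 0 := by
  obtain ⟨p, q, rfl⟩ := exists_eq_evenQuaternion_add a
  simp only [map_add, map_mul, toQuaternion_evenQuaternion, toQuaternion_pseudoscalar] at h
  have hsub : p - q = 0 := by simpa [sub_eq_add_neg] using h 1 (by norm_num)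
  have hadd : p + q = 0 := by simpa using h (-1) (by norm_num)
  obtain rfl : p = q := sub_eq_zero.1 hsub
  obtain rfl : p = 0 := (smul_eq_zero.1 ((two_smul ℝ p).trans hadd)).resolve_left two_ne_zero
  simp only [map_zero, mul_zero, add_zero]

instance : Module.Finite ℝ Cl3 :=
  .of_surjective (evenQuaternion.toLinearMap.coprod
    (LinearMap.mulLeft ℝ pseudoscalar ∘ₗ evenQuaternion.toLinearMap)) fun a =>
    let ⟨p, q, h⟩ := exists_eq_evenQuaternion_add a
    ⟨(p, q), h.symm⟩

theorem eq_zero_of_sum_mul_star_eq_zero {ι : Type*} [Fintype ι] {a : ι → Cl3}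
    (h : ∑ i, a i * star (a i) = 0) : a = 0 := by
  refine funext fun i => eq_zero_of_toQuaternion_eq_zero fun s hs => ?_
  have hsum : ∑ j, Quaternion.normSq (toQuaternion s hs (a j)) = 0 := by
    apply Quaternion.coe_injective (R := ℝ)
    simpa only [map_sum, map_mul, toQuaternion_star, Quaternion.self_mul_star, map_zero,
      ← Quaternion.algebraMap_def] using congrArg (toQuaternion s hs) h
  rw [Finset.sum_eq_zero_iff_of_nonneg fun _ _ => Quaternion.normSq_nonneg] at hsum
  exact Quaternion.normSq_eq_zero.1 (hsum i (Finset.mem_univ i))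

theorem isUnit_mul_conjTranspose_clifford {m n : Type*} [Fintype m] [Fintype n] [DecidableEq m]
    {V : Matrix m n Cl3} {W : Matrix n m Cl3} (h : V * W = 1) : IsUnit (V * V.conjTranspose) :=
  have : IsArtinianRing (Matrix m m Cl3) := .of_finite ℝ _
  isUnit_mul_conjTranspose (fun _ => eq_zero_of_sum_mul_star_eq_zero) h

end CliffordAlgebra

namespace CliffordPoly

theorem pderiv_single (j : Fin 3) (α : Fin 3 →₀ ℕ) (c : Cl3) :
    pderiv j (Finsupp.single α c) = α j • Finsupp.single (α - Finsupp.single j 1) c := by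
  simp [pderiv]

theorem pderiv_apply (j : Fin 3) (P : CliffordPoly) (β : Fin 3 →₀ ℕ) :
    pderiv j P β = (β j + 1) • P (β + Finsupp.single j 1) := by
  induction P using Finsupp.induction_linear with
  | zero => simp
  | add P Q hP hQ => rw [map_add, Finsupp.add_apply, hP, hQ, Finsupp.add_apply, smul_add]
  | single α c =>
    rw [pderiv_single, Finsupp.smul_apply, Finsupp.single_apply, Finsupp.single_apply]
    by_cases hα : α = β + Finsupp.single j 1
    · simp [hα]
    rw [if_neg hα, smul_zero]
    rcases Nat.eq_zero_or_pos (α j) with h0 | h0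
    · rw [h0, zero_smul]
    · rw [if_neg, smul_zero]
      rintro rfl
      exact hα (tsub_add_cancel_of_le (Finsupp.single_le_iff.2 h0)).symm

theorem dirac_apply (P : CliffordPoly) (β : Fin 3 →₀ ℕ) :
    dirac P β = ∑ j, e j * ((β j + 1) • P (β + Finsupp.single j 1)) := by
  simp [dirac, LinearMap.sum_apply, Finsupp.finsetSum_apply, pderiv_apply]

/-- Evaluation at a point as a map of right Clifford modules. -/
noncomputable def evalₗ (x : E3) : CliffordPoly →ₗ[Cl3ᵐᵒᵖ] Cl3 :=
  Finsupp.lsum ℕ fun α => (α.prod fun i n => x i ^ n) • LinearMap.id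

theorem evalₗ_apply (x : E3) (P : CliffordPoly) : evalₗ x P = eval x P := by
  rw [evalₗ, Finsupp.lsum_apply]
  rfl

theorem eval_eq_sum (x : E3) (P : CliffordPoly) :
    eval x P = ∑ α ∈ P.support, (∏ i, x i ^ α i) • P α :=
  Finset.sum_congr rfl fun α _ =>
    congrArg (· • P α) (Finsupp.prod_fintype _ _ fun _ => pow_zero _)

theorem eval_smul {k : ℕ} {P : CliffordPoly}
    (hP : P ∈ Finsupp.supported Cl3 Cl3ᵐᵒᵖ {α : Fin 3 →₀ ℕ | α.degree = k}) (r : ℝ) (x : E3) :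
    eval (r • x) P = r ^ k • eval x P := by
  rw [eval_eq_sum, eval_eq_sum, Finset.smul_sum]
  refine Finset.sum_congr rfl fun α hα => ?_
  have hdeg : α.degree = k := (Finsupp.mem_supported _ P).1 hP hα
  simp only [PiLp.smul_apply, smul_eq_mul, mul_pow, Finset.prod_mul_distrib,
    Finset.prod_pow_eq_pow_sum, ← Finsupp.degree_eq_sum, hdeg, mul_smul]

end CliffordPoly

section CauchyKovalevskaya

open CliffordPoly

/-- The coefficients of the Cauchy–Kovalevskaya extension off the plane `x 0 = 0` of the polynomial
with coefficients `g`: the monogenic equation determines the `x 0`-derivative by the others. -/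
noncomputable def ckCoeff (g : ℕ → ℕ → Cl3) : ℕ → ℕ → ℕ → Cl3
  | 0, b, c => g b c
  | a + 1, b, c => ((a : ℝ) + 1)⁻¹ • (e 0 * ((b + 1) • (e 1 * ckCoeff g a (b + 1) c)
      + (c + 1) • (e 2 * ckCoeff g a b (c + 1))))

theorem ckCoeff_eq_zero {g : ℕ → ℕ → Cl3} {k : ℕ} (hg : ∀ b c, b + c ≠ k → g b c = 0)
    {a b c : ℕ} (h : a + b + c ≠ k) : ckCoeff g a b c = 0 := by
  induction a generalizing b c with
  | zero => exact hg b c (by lia)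
  | succ a ih =>
    rw [ckCoeff, ih (by lia), ih (by lia), mul_zero, mul_zero, smul_zero, smul_zero, add_zero,
      mul_zero, smul_zero]

theorem ckCoeff_dirac (g : ℕ → ℕ → Cl3) (a b c : ℕ) :
    e 0 * ((a + 1) • ckCoeff g (a + 1) b c) + e 1 * ((b + 1) • ckCoeff g a (b + 1) c)
      + e 2 * ((c + 1) • ckCoeff g a b (c + 1)) = 0 := by
  have ha : (a : ℝ) + 1 ≠ 0 := by positivity
  have hsucc : (a + 1) • ckCoeff g (a + 1) b c = e 0 * ((b + 1) • (e 1 * ckCoeff g a (b + 1) c)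
      + (c + 1) • (e 2 * ckCoeff g a b (c + 1))) := by
    rw [← Nat.cast_smul_eq_nsmul ℝ, ckCoeff, Nat.cast_add_one, smul_inv_smul₀ ha]
  rw [hsucc, e_mul_e_mul, mul_smul_comm, mul_smul_comm]
  abel

theorem ckCoeff_monomial_eq_zero {b c : ℕ} {α : Fin 3 →₀ ℕ} (h : α.degree ≠ b + c) :
    ckCoeff (Pi.single b (Pi.single c 1)) (α 0) (α 1) (α 2) = 0 := by
  refine ckCoeff_eq_zero (k := b + c) (fun b' c' hne => ?_) ?_
  · rcases ne_or_eq b' b with hb | rfl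
    · rw [Pi.single_eq_of_ne hb, Pi.zero_apply]
    · rw [Pi.single_eq_same, Pi.single_eq_of_ne (by lia)]
  · rwa [Finsupp.degree_eq_sum, Fin.sum_univ_three] at h

/-- The monogenic extension of the monomial `x 1 ^ b * x 2 ^ c`. -/
noncomputable def ckMonomial (b c : ℕ) : CliffordPoly :=
  Finsupp.ofSupportFinite
    (fun α => ckCoeff (Pi.single b (Pi.single c 1)) (α 0) (α 1) (α 2)) <|
    (Finsupp.finite_of_degree_le (b + c)).subset fun _ hα =>
      (not_imp_comm.1 ckCoeff_monomial_eq_zero hα).le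

theorem ckMonomial_apply (b c : ℕ) (α : Fin 3 →₀ ℕ) :
    ckMonomial b c α = ckCoeff (Pi.single b (Pi.single c 1)) (α 0) (α 1) (α 2) :=
  rfl

theorem ckMonomial_mem_sphericalMonogenics (b c : ℕ) :
    ckMonomial b c ∈ sphericalMonogenics (b + c) := by
  refine ⟨(Finsupp.mem_supported _ _).2 fun α hα => ?_, LinearMap.mem_ker.2 ?_⟩
  · exact not_imp_comm.1 ckCoeff_monomial_eq_zero (Finsupp.mem_support_iff.1 hα)
  · ext β
    rw [dirac_apply, Fin.sum_univ_three]
    simpa [ckMonomial_apply] using ckCoeff_dirac _ (β 0) (β 1) (β 2)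

/-- The point of the plane `x 0 = 0` with the given complex coordinate. -/
noncomputable def planePoint (z : ℂ) : E3 := !₂[0, z.re, z.im]

theorem eval_planePoint_ckMonomial (b c : ℕ) (z : ℂ) :
    eval (planePoint z) (ckMonomial b c) = algebraMap ℝ Cl3 (z.re ^ b * z.im ^ c) := by
  let γ : Fin 3 →₀ ℕ := Finsupp.equivFunOnFinite.symm ![0, b, c]
  rw [eval_eq_sum, Finset.sum_eq_single γ]
  · simp [ckMonomial_apply, ckCoeff, planePoint, γ, Fin.prod_univ_three,
      Algebra.algebraMap_eq_smul_one]
  · intro α _ hα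
    by_cases hα0 : α 0 = 0
    · suffices h : (Pi.single b (Pi.single c 1) : ℕ → ℕ → Cl3) (α 1) (α 2) = 0 by
        rw [ckMonomial_apply, hα0, ckCoeff, h, smul_zero]
      rcases ne_or_eq (α 1) b with hb | hb
      · rw [Pi.single_eq_of_ne hb, Pi.zero_apply]
      · rw [hb, Pi.single_eq_same, Pi.single_eq_of_ne fun hc => hα ?_]
        ext i
        fin_cases i
        exacts [hα0, hb, hc]
    · simp [Fin.prod_univ_three, planePoint, zero_pow hα0]
  · intro h
    rw [Finsupp.notMem_support_iff.1 h, smul_zero]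

end CauchyKovalevskaya

section MonogenicKernel

open CliffordPoly

theorem analyticAt_fst_apply (p : E3 × E3) (i : Fin 3) : AnalyticAt ℝ (fun p => p.1 i) p :=
  ((EuclideanSpace.proj (𝕜 := ℝ) i).comp (ContinuousLinearMap.fst ℝ E3 E3)).analyticAt p

theorem analyticAt_snd_apply (p : E3 × E3) (i : Fin 3) : AnalyticAt ℝ (fun p => p.2 i) p :=
  ((EuclideanSpace.proj (𝕜 := ℝ) i).comp (ContinuousLinearMap.snd ℝ E3 E3)).analyticAt p

theorem monogenicKernel_smul {k d : ℕ} {Y : Fin d → CliffordPoly}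
    (hY : ∀ l, Y l ∈ sphericalMonogenics k) (r s : ℝ) (x y : E3) :
    monogenicKernel Y (r • x) (s • y) = (r * s) ^ k • monogenicKernel Y x y := by
  simp only [monogenicKernel, Finset.smul_sum, eval_smul (hY _).1, CliffordAlgebra.star_smul,
    smul_mul_smul_comm, mul_pow]

theorem weaklyAnalytic_monogenicKernel {d : ℕ} (Y : Fin d → CliffordPoly) :
    WeaklyAnalytic fun p : E3 × E3 => monogenicKernel Y p.1 p.2 := by
  simp only [monogenicKernel, eval_eq_sum, star_sum, CliffordAlgebra.star_smul, Finset.sum_mul_sum,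
    smul_mul_smul_comm]
  refine .sum fun l _ => .sum fun α _ => .sum fun β _ => .smul_const (fun p _ => ?_) _
  have hfst := analyticAt_fst_apply p
  have hsnd := analyticAt_snd_apply p
  fun_prop

/-- The values of a family of Clifford polynomials at a family of points. -/
noncomputable def evalMatrix {m n : Type*} (x : m → E3) (Y : n → CliffordPoly) : Matrix m n Cl3 :=
  Matrix.of fun i l => eval (x i) (Y l)

theorem kernelMatrix_monogenicKernel {m : Type*} {d : ℕ} (Y : Fin d → CliffordPoly) (x : m → E3) :
    kernelMatrix (monogenicKernel Y) x = evalMatrix x Y * (evalMatrix x Y).conjTranspose :=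
  rfl

theorem exists_evalMatrix_mul_eq {l m n : Type*} [Fintype n] {Y : n → CliffordPoly}
    {P : l → CliffordPoly} (hP : ∀ b, P b ∈ Submodule.span Cl3ᵐᵒᵖ (Set.range Y)) (x : m → E3) :
    ∃ C : Matrix n l Cl3, evalMatrix x Y * C = evalMatrix x P := by
  simp only [Submodule.mem_span_range_iff_exists_fun] at hP
  choose c hc using hP
  refine ⟨Matrix.of fun l b => (c b l).unop, ?_⟩
  ext i b
  simp only [evalMatrix, Matrix.mul_apply, Matrix.of_apply, ← hc, ← evalₗ_apply, map_sum, map_smul,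
    MulOpposite.smul_eq_mul_unop]

theorem isUnit_evalMatrix_ckMonomial {n k : ℕ} :
    IsUnit (evalMatrix (fun i : Fin n => planePoint (i + Complex.I))
      fun b : Fin n => ckMonomial b (k - b)) := by
  have hvandermonde : IsUnit (Matrix.vandermonde fun i : Fin n => (i : ℝ)) := by
    rw [Matrix.isUnit_iff_isUnit_det, isUnit_iff_ne_zero, Matrix.det_vandermonde_ne_zero_iff]
    exact Nat.cast_injective.comp Fin.val_injective
  convert hvandermonde.map (algebraMap ℝ Cl3).mapMatrix
  ext i b
  simp [evalMatrix, eval_planePoint_ckMonomial]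

theorem isUnit_kernelMatrix_monogenicKernel {n k d : ℕ} (hn : n ≤ k + 1)
    {Y : Fin d → CliffordPoly}
    (hY : Submodule.span Cl3ᵐᵒᵖ (Set.range Y) = sphericalMonogenics k) :
    IsUnit (kernelMatrix (monogenicKernel Y) fun i : Fin n => planePoint (i + Complex.I)) := by
  have hmem (b : Fin n) : ckMonomial b (k - b) ∈ Submodule.span Cl3ᵐᵒᵖ (Set.range Y) := by
    have h := ckMonomial_mem_sphericalMonogenics b (k - b)
    rwa [Nat.add_sub_cancel' (by lia), ← hY] at h
  obtain ⟨C, hC⟩ := exists_evalMatrix_mul_eq hmem fun i : Fin n => planePoint (i + Complex.I)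
  obtain ⟨W, hW⟩ := (hC ▸ isUnit_evalMatrix_ckMonomial).exists_right_inv
  rw [kernelMatrix_monogenicKernel]
  exact isUnit_mul_conjTranspose_clifford ((Matrix.mul_assoc _ _ _).symm.trans hW)

end MonogenicKernel

section BinomialPow

open PowerSeries

theorem eq_of_mul_derivative_eq {K : Type*} [Field K] [CharZero K] {u p F G : K⟦X⟧} (hu : u ≠ 0)
    (hF : u * derivative K F = p * F) (hG : u * derivative K G = p * G)
    (h : constantCoeff F = constantCoeff G) (h0 : constantCoeff G ≠ 0) : F = G := by
  have hGG : G * G⁻¹ = 1 := PowerSeries.mul_inv_cancel G h0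
  suffices hquot : F * G⁻¹ = 1 by linear_combination G * hquot - F * hGG
  refine derivative.ext (mul_left_cancel₀ hu ?_) ?_
  · simp only [Derivation.leibniz, derivative_inv', smul_eq_mul, derivative_one]
    linear_combination G⁻¹ * hF - F * G⁻¹ ^ 2 * hG - p * F * G⁻¹ * hGG
  · rw [map_mul, constantCoeff_inv, map_one, h, mul_inv_cancel₀ h0]

variable {R K : Type*} [CommRing R] [BinomialRing R] [Field K] [Algebra R K]

theorem derivative_binomialSeries (r : R) :
    derivative K (binomialSeries K r) = algebraMap R K r • binomialSeries K (r - 1) := by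
  ext n
  have h := Ring.choose_smul_choose r (Nat.le_add_left 1 n)
  rw [Nat.choose_one_right, Ring.choose_one_right, Nat.cast_one, Nat.add_sub_cancel,
    nsmul_eq_mul] at h
  rw [coeff_derivative, coeff_smul, binomialSeries_coeff, binomialSeries_coeff,
    algebraMap_smul, smul_smul, ← h, mul_smul, Nat.cast_smul_eq_nsmul, nsmul_eq_mul, mul_comm,
    Nat.cast_succ]

/-- The formal power `(1 + a) ^ r` of a power series, for `a` without constant term. -/
noncomputable def binomialPow (r : R) (a : K⟦X⟧) : K⟦X⟧ :=
  (binomialSeries K r).subst a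

variable {a b : K⟦X⟧}

theorem binomialPow_add (ha : HasSubst a) (r s : R) :
    binomialPow (r + s) a = binomialPow r a * binomialPow s a := by
  rw [binomialPow, binomialSeries_add, subst_mul ha, binomialPow, binomialPow]

variable (R) in
theorem binomialPow_one (ha : HasSubst a) : binomialPow (1 : R) a = 1 + a := by
  rw [binomialPow, ← Nat.cast_one, binomialSeries_nat, pow_one, subst_add ha, subst_X ha,
    ← coe_substAlgHom ha, map_one]

theorem binomialPow_eq_one_add_mul (ha : HasSubst a) (r : R) :
    binomialPow r a = (1 + a) * binomialPow (r - 1) a := by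
  rw [← binomialPow_one R ha, ← binomialPow_add ha, add_sub_cancel]

theorem derivative_binomialPow (ha : HasSubst a) (r : R) :
    derivative K (binomialPow r a) =
      algebraMap R K r • (derivative K a * binomialPow (r - 1) a) := by
  rw [binomialPow, derivative_subst ha, derivative_binomialSeries, subst_smul ha, smul_mul_assoc,
    mul_comm, binomialPow]

theorem one_add_mul_derivative_binomialPow (ha : HasSubst a) (r : R) :
    (1 + a) * derivative K (binomialPow r a) =
      algebraMap R K r • derivative K a * binomialPow r a := by
  rw [derivative_binomialPow ha, mul_smul_comm, mul_left_comm, ← binomialPow_eq_one_add_mul ha,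
    smul_mul_assoc]

theorem constantCoeff_binomialPow (ha : constantCoeff a = 0) (r : R) :
    constantCoeff (binomialPow r a) = 1 := by
  rw [binomialPow, ← coeff_zero_eq_constantCoeff_apply, coeff_subst' (.of_constantCoeff_zero' ha),
    finsum_eq_single _ 0 fun n hn => ?_]
  · rw [binomialSeries_coeff, Ring.choose_zero_right, one_smul, pow_zero, coeff_zero_one, one_smul]
  · rw [coeff_zero_eq_constantCoeff_apply, map_pow, ha, zero_pow hn, smul_zero]

theorem binomialPow_mul [CharZero K] (ha : constantCoeff a = 0) (hb : constantCoeff b = 0) (r : R) :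
    binomialPow r a * binomialPow r b = binomialPow r (a + b + a * b) := by
  have hab : constantCoeff (a + b + a * b) = 0 := by simp only [map_add, map_mul, ha, hb]; ring
  have hDa := one_add_mul_derivative_binomialPow (.of_constantCoeff_zero' ha) r
  have hDb := one_add_mul_derivative_binomialPow (.of_constantCoeff_zero' hb) r
  have hDab := one_add_mul_derivative_binomialPow (.of_constantCoeff_zero' hab) r
  refine eq_of_mul_derivative_eq (fun h => ?_) ?_ hDab ?_ ?_
  · simpa only [map_add, map_one, hab, add_zero, map_zero, one_ne_zero]
      using congrArg constantCoeff h
  · simp only [smul_eq_C_mul, map_add, Derivation.leibniz, smul_eq_mul] at hDa hDb ⊢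
    linear_combination (1 + b) * binomialPow r b * hDa + (1 + a) * binomialPow r a * hDb
  · rw [map_mul, constantCoeff_binomialPow ha, constantCoeff_binomialPow hb,
      constantCoeff_binomialPow hab, one_mul]
  · rw [constantCoeff_binomialPow hab]
    exact one_ne_zero

theorem coeff_binomialPow_smul_X (r : R) (w : K) (n : ℕ) :
    coeff n (binomialPow r (w • X)) = Ring.choose r n • w ^ n := by
  rw [binomialPow, ← rescale_eq_subst, coeff_rescale, binomialSeries_coeff, mul_smul_comm, mul_one]

theorem coeff_binomialPow (ha : constantCoeff a = 0) (r : R) (n : ℕ) :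
    coeff n (binomialPow r a) = ∑ m ∈ Finset.range (n + 1), Ring.choose r m • coeff n (a ^ m) := by
  rw [binomialPow, coeff_subst' (.of_constantCoeff_zero' ha)]
  simp only [binomialSeries_coeff, smul_assoc, one_smul]
  refine finsum_eq_sum_of_support_subset _ fun m hm => ?_
  rw [Finset.coe_range, Set.mem_Iio, Nat.lt_succ_iff]
  refine le_of_not_gt fun hlt => hm ?_
  have hzero := X_pow_dvd_iff.1 (pow_dvd_pow_of_dvd (X_dvd_iff.2 ha) m) n hlt
  exact (congrArg (Ring.choose r m • ·) hzero).trans (smul_zero _)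

theorem coeff_smul_X_add_smul_X_sq_pow (s t : K) (m j : ℕ) :
    coeff (m + j) ((s • X + t • X ^ 2) ^ m) = m.choose j • (s ^ (m - j) * t ^ j) := by
  have hexpand : (s • X + t • X ^ 2 : K⟦X⟧) ^ m =
      X ^ m * ∑ i ∈ Finset.range (m + 1), (m.choose i • (s ^ (m - i) * t ^ i)) • X ^ i := by
    have hfactor : (s • X + t • X ^ 2 : K⟦X⟧) = X * (t • X + C s) := by
      simp only [smul_eq_C_mul]
      ring
    rw [hfactor, mul_pow, add_pow]
    refine congrArg (X ^ m * ·) (Finset.sum_congr rfl fun i _ => ?_)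
    simp only [smul_eq_C_mul, nsmul_eq_mul, map_mul, map_pow, map_natCast]
    ring
  rw [hexpand, add_comm m j, coeff_X_pow_mul, map_sum]
  simp only [coeff_smul, coeff_X_pow, smul_eq_mul, mul_ite, mul_one, mul_zero, Finset.sum_ite_eq,
    Finset.mem_range, Nat.lt_succ_iff]
  exact ite_eq_left_iff.2 fun h => by rw [Nat.choose_eq_zero_of_lt (not_le.1 h), zero_smul]

theorem coeff_binomialPow_quadratic (r : R) (s t : K) (n : ℕ) :
    coeff n (binomialPow r (s • X + t • X ^ 2)) = ∑ j ∈ Finset.range (n / 2 + 1),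
      Ring.choose r (n - j) • (n - j).choose j • (s ^ (n - 2 * j) * t ^ j) := by
  have hsubset : Finset.range (n / 2 + 1) ⊆ Finset.range (n + 1) :=
    Finset.range_subset_range.2 (by lia)
  rw [coeff_binomialPow (by simp), ← Finset.sum_range_reflect, ← Finset.sum_subset hsubset]
  · refine Finset.sum_congr rfl fun j hj => ?_
    have h := coeff_smul_X_add_smul_X_sq_pow s t (n - j) j
    rw [Finset.mem_range] at hj
    rw [Nat.sub_add_cancel (by lia), Nat.sub_sub, ← two_mul] at h
    rw [Nat.add_sub_cancel, h]
  · intro j hj hj'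
    rw [Finset.mem_range] at hj hj'
    have h := coeff_smul_X_add_smul_X_sq_pow s t (n - j) j
    rw [Nat.choose_eq_zero_of_lt (by lia), zero_smul, Nat.sub_add_cancel (by lia)] at h
    rw [Nat.add_sub_cancel, h, smul_zero]

end BinomialPow

section Gegenbauer

open PowerSeries

theorem choose_neg_eq_multichoose (μ : ℝ) (n : ℕ) :
    Ring.choose (-μ) n = (-1) ^ n * Ring.multichoose μ n := by
  rw [Ring.choose_neg', Units.smul_def, Ring.multichoose_eq, zsmul_eq_mul,
    Int.cast_negOnePow_natCast]

theorem multichoose_eq_ascPochhammer_div (μ : ℝ) (n : ℕ) :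
    Ring.multichoose μ n = (ascPochhammer ℝ n).eval μ / n.factorial := by
  rw [eq_div_iff (by positivity), mul_comm, ← nsmul_eq_mul,
    Ring.factorial_nsmul_multichoose_eq_ascPochhammer, Polynomial.ascPochhammer_smeval_eq_eval]

theorem multichoose_pos {μ : ℝ} (hμ : 0 < μ) (n : ℕ) : 0 < Ring.multichoose μ n := by
  rw [multichoose_eq_ascPochhammer_div]
  exact div_pos (ascPochhammer_pos n μ hμ) (by positivity)

theorem coeff_X_mul_derivative {K : Type*} [Field K] (F : K⟦X⟧) (n : ℕ) :
    coeff n (X * derivative K F) = n * coeff n F := by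
  cases n with
  | zero => simp
  | succ n => rw [coeff_succ_X_mul, coeff_derivative, Nat.cast_succ, mul_comm]

variable {K : Type*} [Field K] [Algebra ℝ K]

theorem coeff_binomialPow_neg_smul_X (μ : ℝ) (w : K) (n : ℕ) :
    coeff n (binomialPow (-μ) (-w • X)) = Ring.multichoose μ n • w ^ n := by
  have hsign : (-1 : K) ^ n * (-1) ^ n = 1 := by rw [← mul_pow, neg_one_mul, neg_neg, one_pow]
  rw [coeff_binomialPow_smul_X, choose_neg_eq_multichoose, neg_pow w, Algebra.smul_def,
    Algebra.smul_def, map_mul, map_pow, map_neg, map_one]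
  linear_combination algebraMap ℝ K (Ring.multichoose μ n) * w ^ n * hsign

/-- The generating function `(1 - s X + t X ^ 2) ^ (-μ)` of the Gegenbauer polynomials. -/
noncomputable def gegenbauerSeries (μ : ℝ) (s t : K) : K⟦X⟧ :=
  binomialPow (-μ) (-s • X + t • X ^ 2)

/-- The Gegenbauer polynomial `C_n^μ` made homogeneous, with `s` of degree one and `t` of degree
two, so that its value at `x` is `homGegenbauer μ n (2 * x) 1`. -/
noncomputable def homGegenbauer (μ : ℝ) (n : ℕ) (s t : K) : K :=
  coeff n (gegenbauerSeries μ s t)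

theorem homGegenbauer_eq_sum (μ : ℝ) (n : ℕ) (s t : K) :
    homGegenbauer μ n s t = ∑ j ∈ Finset.range (n / 2 + 1),
      ((-1) ^ j * (ascPochhammer ℝ (n - j)).eval μ / (j.factorial * (n - 2 * j).factorial)) •
        (s ^ (n - 2 * j) * t ^ j) := by
  rw [homGegenbauer, gegenbauerSeries, coeff_binomialPow_quadratic]
  refine Finset.sum_congr rfl fun j hj => ?_
  rw [Finset.mem_range] at hj
  have hsub : n - j - j = n - 2 * j := by lia
  have hneg : (-s) ^ (n - 2 * j) = ((-1 : ℝ) ^ (n - 2 * j)) • s ^ (n - 2 * j) := by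
    rw [neg_pow, Algebra.smul_def, map_pow, map_neg, map_one]
  have hsign : (-1 : ℝ) ^ (n - j) * (-1) ^ (n - 2 * j) = (-1) ^ j := by
    rw [← pow_add, show n - j + (n - 2 * j) = 2 * (n - 2 * j) + j by lia, pow_add, pow_mul,
      neg_one_sq, one_pow, one_mul]
  rw [choose_neg_eq_multichoose, multichoose_eq_ascPochhammer_div, hneg, smul_mul_assoc,
    ← Nat.cast_smul_eq_nsmul ℝ, smul_smul, smul_smul, Nat.cast_choose ℝ (by lia : j ≤ n - j), hsub,
    ← hsign]
  congr 1
  field_simp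

theorem gegenbauer_eq_homGegenbauer (μ : ℝ) (n : ℕ) (t : ℝ) :
    gegenbauer μ n t = homGegenbauer μ n (2 * t) 1 := by
  simp only [gegenbauer, homGegenbauer_eq_sum, one_pow, mul_one, smul_eq_mul]

theorem algebraMap_homGegenbauer (μ : ℝ) (n : ℕ) (s t : ℝ) :
    algebraMap ℝ K (homGegenbauer μ n s t) =
      homGegenbauer μ n (algebraMap ℝ K s) (algebraMap ℝ K t) := by
  simp only [homGegenbauer_eq_sum, map_sum, smul_eq_mul, map_mul, map_pow, Algebra.smul_def]

theorem homGegenbauer_mul (μ : ℝ) (n : ℕ) (r s t : K) :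
    homGegenbauer μ n (r * s) (r ^ 2 * t) = r ^ n * homGegenbauer μ n s t := by
  simp only [homGegenbauer_eq_sum, Finset.mul_sum, mul_smul_comm]
  refine Finset.sum_congr rfl fun j hj => ?_
  rw [Finset.mem_range] at hj
  have hr : r ^ (n - 2 * j) * (r ^ 2) ^ j = r ^ n := by
    rw [← pow_mul, ← pow_add, Nat.sub_add_cancel (by lia)]
  rw [mul_pow, mul_pow, mul_mul_mul_comm, hr]

theorem gegenbauerSeries_add_mul [CharZero K] (μ : ℝ) (w v : K) :
    gegenbauerSeries μ (w + v) (w * v) =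
      binomialPow (-μ) (-w • X) * binomialPow (-μ) (-v • X) := by
  have harg : -(w + v) • X + (w * v) • X ^ 2 =
      (-w • X + -v • X + -w • X * -v • X : K⟦X⟧) := by
    simp only [smul_eq_C_mul, map_add, map_neg, map_mul]
    ring
  rw [binomialPow_mul (by simp) (by simp), ← harg, gegenbauerSeries]

theorem gegenbauerSeries_eq_mul (μ : ℝ) (s t : K) :
    gegenbauerSeries μ s t = (1 - C s * X + C t * X ^ 2) * gegenbauerSeries (μ + 1) s t := by
  rw [gegenbauerSeries, binomialPow_eq_one_add_mul (.of_constantCoeff_zero' (by simp)), ← neg_add',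
    gegenbauerSeries]
  simp only [smul_eq_C_mul, map_neg]
  ring

theorem derivative_gegenbauerSeries (μ : ℝ) (s t : K) :
    derivative K (gegenbauerSeries μ s t) =
      C (algebraMap ℝ K μ) * (C s - 2 * C t * X) * gegenbauerSeries (μ + 1) s t := by
  rw [gegenbauerSeries, derivative_binomialPow (.of_constantCoeff_zero' (by simp)), ← neg_add',
    gegenbauerSeries, smul_eq_C_mul]
  simp only [smul_eq_C_mul, map_neg, map_add, Derivation.leibniz, Derivation.leibniz_pow,
    derivative_X, derivative_C, smul_eq_mul, nsmul_eq_mul, mul_one, mul_zero, add_zero,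
    Nat.add_one_sub_one, pow_one, Nat.cast_ofNat]
  ring

theorem gegenbauerSeries_add_X_mul_derivative [CharZero K] (μ : ℝ) (w v : K) :
    C (2 * algebraMap ℝ K μ) * gegenbauerSeries μ (w + v) (w * v)
      + X * derivative K (gegenbauerSeries μ (w + v) (w * v))
      + C (algebraMap ℝ K μ * (w - v)) * (X * gegenbauerSeries (μ + 1) (w + v) (w * v)) =
      C (2 * algebraMap ℝ K μ) *
        (binomialPow (-(μ + 1)) (-w • X) * binomialPow (-μ) (-v • X)) := by
  rw [derivative_gegenbauerSeries, gegenbauerSeries_eq_mul, gegenbauerSeries_add_mul,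
    binomialPow_eq_one_add_mul (a := -v • X) (.of_constantCoeff_zero' (by simp)) (-μ), ← neg_add']
  simp only [smul_eq_C_mul, map_add, map_sub, map_neg, map_mul, map_ofNat]
  ring

theorem homGegenbauer_add_homGegenbauer [CharZero K] (μ : ℝ) (k : ℕ) (w v : K) :
    (k + 2 * algebraMap ℝ K μ) * homGegenbauer μ k (w + v) (w * v) + algebraMap ℝ K μ * (w - v) *
      (if k = 0 then 0 else homGegenbauer (μ + 1) (k - 1) (w + v) (w * v)) =
      2 * algebraMap ℝ K μ * ∑ p ∈ Finset.HasAntidiagonal.antidiagonal k,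
        (Ring.multichoose (μ + 1) p.1 * Ring.multichoose μ p.2) • (w ^ p.1 * v ^ p.2) := by
  have h := congrArg (coeff k) (gegenbauerSeries_add_X_mul_derivative μ w v)
  have hX (F : K⟦X⟧) : coeff k (X * F) = if k = 0 then 0 else coeff (k - 1) F := by
    cases k with
    | zero => simp
    | succ k => simp
  rw [map_add, map_add, coeff_C_mul, coeff_C_mul, coeff_C_mul, coeff_X_mul_derivative, hX,
    coeff_mul] at h
  simp only [coeff_binomialPow_neg_smul_X, smul_mul_smul_comm] at h
  simp only [homGegenbauer]
  linear_combination h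

end Gegenbauer

section ClosedForm

/-- The extension of `closedFormKernel k` from the sphere to a kernel on the whole space that is
homogeneous of degree `k` in each variable. -/
noncomputable def homKernel (k : ℕ) (x y : E3) : Cl3 :=
  algebraMap ℝ Cl3
      ((k + 1) * homGegenbauer (1 / 2) k (2 * inner ℝ x y) (inner ℝ x x * inner ℝ y y))
    + (if k = 0 then 0 else
        homGegenbauer (3 / 2) (k - 1) (2 * inner ℝ x y) (inner ℝ x x * inner ℝ y y)) • wedge x y

theorem gramMatrix_closedFormKernel (k : ℕ) {n : ℕ} (η : Fin n → S2) :
    gramMatrix (closedFormKernel k) η = kernelMatrix (homKernel k) fun i => (η i : E3) := by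
  ext i j
  have hinner (x : S2) : inner ℝ (x : E3) (x : E3) = (1 : ℝ) := by
    rw [real_inner_self_eq_norm_sq, norm_eq_of_mem_sphere, one_pow]
  simp only [gramMatrix, kernelMatrix, Matrix.of_apply, closedFormKernel, homKernel, hinner,
    mul_one, gegenbauer_eq_homGegenbauer]

theorem wedge_smul (r s : ℝ) (x y : E3) : wedge (r • x) (s • y) = (r * s) • wedge x y := by
  simp only [wedge, Finset.smul_sum, smul_smul, PiLp.smul_apply, smul_eq_mul]
  refine Finset.sum_congr rfl fun i _ => Finset.sum_congr rfl fun j _ => ?_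
  congr 1
  ring

theorem homKernel_smul (k : ℕ) (r s : ℝ) (x y : E3) :
    homKernel k (r • x) (s • y) = (r * s) ^ k • homKernel k x y := by
  have hxy : 2 * inner ℝ (r • x) (s • y) = (r * s) * (2 * inner ℝ x y) := by
    rw [real_inner_smul_left, real_inner_smul_right]
    ring
  have hxxyy : inner ℝ (r • x) (r • x) * inner ℝ (s • y) (s • y) =
      (r * s) ^ 2 * (inner ℝ x x * inner ℝ y y) := by
    simp only [real_inner_smul_left, real_inner_smul_right]
    ring
  rw [homKernel, homKernel, hxy, hxxyy, homGegenbauer_mul, homGegenbauer_mul, wedge_smul]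
  rcases k with _ | k
  · simp
  · simp only [Algebra.algebraMap_eq_smul_one, Nat.add_sub_cancel, Nat.add_eq_zero_iff,
      one_ne_zero, and_false, if_false]
    module

theorem weaklyAnalytic_homKernel (k : ℕ) :
    WeaklyAnalytic fun p : E3 × E3 => homKernel k p.1 p.2 := by
  have hgegenbauer (μ : ℝ) (n : ℕ) (p : E3 × E3) : AnalyticAt ℝ (fun p : E3 × E3 =>
      homGegenbauer μ n (2 * inner ℝ p.1 p.2) (inner ℝ p.1 p.1 * inner ℝ p.2 p.2)) p := by
    have hfst := analyticAt_fst_apply p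
    have hsnd := analyticAt_snd_apply p
    simp only [homGegenbauer_eq_sum, PiLp.inner_apply, Fin.sum_univ_three, RCLike.inner_apply,
      conj_trivial, smul_eq_mul]
    fun_prop
  simp only [homKernel, wedge, Finset.smul_sum, smul_smul, Algebra.algebraMap_eq_smul_one]
  refine .add (.smul_const (fun p _ => ?_) 1) <|
    .sum fun i _ => .sum fun j _ => .smul_const (fun p _ => ?_) _
  · exact analyticAt_const.mul (hgegenbauer _ _ p)
  · have hfst := analyticAt_fst_apply p
    have hsnd := analyticAt_snd_apply p
    have hcoeff := hgegenbauer (3 / 2) (k - 1) p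
    split_ifs <;> fun_prop

/-- The complex numbers inside the Clifford algebra, with imaginary unit `e 1 * e 2`. -/
noncomputable def complexToCl3 : ℂ →ₐ[ℝ] Cl3 :=
  evenQuaternion.comp Quaternion.ofComplex

theorem inner_planePoint (z u : ℂ) :
    inner ℝ (planePoint z) (planePoint u) = (star z * u).re := by
  simp [planePoint, PiLp.inner_apply, Fin.sum_univ_three, mul_comm]

theorem wedge_planePoint (z u : ℂ) :
    wedge (planePoint z) (planePoint u) = (star z * u).im • complexToCl3 Complex.I := by
  have h0 : Finset.Ioi (0 : Fin 3) = {1, 2} := by decide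
  have h1 : Finset.Ioi (1 : Fin 3) = {2} := by decide
  have h2 : Finset.Ioi (2 : Fin 3) = ∅ := by decide
  simp [wedge, Fin.sum_univ_three, h0, h1, h2, planePoint, complexToCl3, evenQuaternion_apply,
    sub_eq_add_neg]

theorem homKernel_planePoint (k : ℕ) (z u : ℂ) :
    homKernel k (planePoint z) (planePoint u) =
      complexToCl3 (∑ p ∈ Finset.HasAntidiagonal.antidiagonal k,
        (Ring.multichoose (3 / 2 : ℝ) p.1 * Ring.multichoose (1 / 2 : ℝ) p.2) •
          ((star z * u) ^ p.1 * (z * star u) ^ p.2)) := by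
  set w := star z * u with hw
  have hv : z * star u = star w := by rw [hw, star_mul, star_star, mul_comm]
  have hadd : algebraMap ℝ ℂ (2 * inner ℝ (planePoint z) (planePoint u)) = w + star w := by
    rw [inner_planePoint]
    exact (Complex.add_conj w).symm
  have hmul : algebraMap ℝ ℂ (inner ℝ (planePoint z) (planePoint z) *
      inner ℝ (planePoint u) (planePoint u)) = w * star w := by
    have hnorm (z : ℂ) : algebraMap ℝ ℂ (inner ℝ (planePoint z) (planePoint z)) = star z * z := by
      rw [inner_planePoint]
      exact Complex.conj_eq_iff_re.1 (by simp [mul_comm])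
    rw [map_mul, hnorm, hnorm, hw, star_mul, star_star]
    ring
  have hsub : w.im • Complex.I = algebraMap ℝ ℂ (1 / 2) * (w - star w) := by
    have h := Complex.sub_conj w
    rw [← starRingEnd_apply, h, Complex.real_smul]
    simp only [one_div, map_inv₀, Complex.coe_algebraMap, Complex.ofReal_ofNat, Complex.ofReal_mul]
    ring
  have hsum := homGegenbauer_add_homGegenbauer (1 / 2) k w (star w)
  have hscalar : 2 * algebraMap ℝ ℂ (1 / 2) = 1 := by simp
  rw [← hsub, ← hadd, ← hmul, ← algebraMap_homGegenbauer, ← algebraMap_homGegenbauer, hscalar,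
    one_mul, show (1 / 2 + 1 : ℝ) = 3 / 2 by norm_num, ← map_zero (algebraMap ℝ ℂ),
    ← apply_ite (algebraMap ℝ ℂ)] at hsum
  rw [hv, ← hsum, homKernel, wedge_planePoint, ← hw]
  simp only [map_add, map_mul, map_natCast, map_one, AlgHom.commutes, Algebra.smul_def,
    ← Algebra.commutes]

theorem vecMul_rectVandermonde_injective {F : Type*} [Field F] {n m : ℕ} (hnm : n ≤ m)
    {v w : Fin n → F} (hw : ∀ i, w i ≠ 0) (hvw : Function.Injective fun i => v i / w i) :
    Function.Injective (Matrix.rectVandermonde v w m).vecMul := by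
  refine (injective_iff_map_eq_zero (Matrix.vecMulLinear (Matrix.rectVandermonde v w m))).2
    fun a ha => ?_
  have hscaled : (fun i => a i * w i ^ (m - 1)) = 0 := by
    refine Matrix.eq_zero_of_forall_pow_sum_mul_pow_eq_zero hvw fun j => ?_
    have haj : ∑ i, a i * Matrix.rectVandermonde v w m i (Fin.castLE hnm j) = 0 :=
      congrFun ha (Fin.castLE hnm j)
    refine (Finset.sum_congr rfl fun i _ => ?_).trans haj
    have hsplit : w i ^ (m - 1) = w i ^ (j : ℕ) * w i ^ (m - (j + 1)) := by
      rw [← pow_add]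
      congr 1
      lia
    rw [Matrix.rectVandermonde_apply, Fin.val_rev, Fin.val_castLE, hsplit, div_pow]
    field_simp [hw i]
  exact funext fun i => (mul_eq_zero.1 (congrFun hscaled i)).resolve_right (pow_ne_zero _ (hw i))

open scoped ComplexOrder in
theorem isUnit_kernelMatrix_homKernel {n k : ℕ} (hn : n ≤ k + 1) :
    IsUnit (kernelMatrix (homKernel k) fun i : Fin n => planePoint (i + Complex.I)) := by
  let z (i : Fin n) : ℂ := i + Complex.I
  let A : Matrix (Fin n) (Fin (k + 1)) ℂ := Matrix.rectVandermonde (star z) z (k + 1)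
  let c (a : Fin (k + 1)) : ℝ :=
    Ring.multichoose (3 / 2 : ℝ) a * Ring.multichoose (1 / 2 : ℝ) (k - a)
  have hz (i : Fin n) : z i ≠ 0 := fun h => by simpa [z] using congrArg Complex.im h
  have hinj : Function.Injective fun i => star z i / z i := by
    intro i j hij
    have hcast : (i : ℝ) + -j = j + -i := by
      simpa [z] using congrArg Complex.im ((div_eq_div_iff (hz i) (hz j)).1 hij)
    exact Fin.ext (Nat.cast_injective (R := ℝ) (by linarith))
  have hc (a : Fin (k + 1)) : (0 : ℂ) < c a := by
    have hpos : 0 < c a :=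
      mul_pos (multichoose_pos (by norm_num) _) (multichoose_pos (by norm_num) _)
    exact_mod_cast hpos
  have hfactor : kernelMatrix (homKernel k) (fun i => planePoint (z i)) =
      complexToCl3.mapMatrix (A * Matrix.diagonal (fun a => (c a : ℂ)) * A.conjTranspose) := by
    ext i j
    rw [kernelMatrix, Matrix.of_apply, homKernel_planePoint, AlgHom.mapMatrix_apply,
      Matrix.map_apply, Matrix.mul_apply, Finset.Nat.sum_antidiagonal_eq_sum_range_succ_mk,
      Finset.sum_range]
    refine congrArg complexToCl3 (Finset.sum_congr rfl fun a _ => ?_)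
    have hrev : (a.rev : ℕ) = k - a :=
      (Fin.val_rev a).trans (Nat.add_sub_add_right k 1 a)
    simp only [Matrix.mul_diagonal, Matrix.conjTranspose_apply, A, Matrix.rectVandermonde_apply,
      hrev, star_mul, star_pow, Pi.star_apply, star_star, Complex.real_smul, c, mul_pow]
    ring
  rw [hfactor]
  exact ((Matrix.PosDef.diagonal hc).mul_mul_conjTranspose_same
    (vecMul_rectVandermonde_injective hn hz hinj)).isUnit.map _

end ClosedForm

theorem mainTheorem4_general {n k : ℕ} (hn : n ≤ k + 1) :
    (∀ (d : ℕ) (Y : Fin d → CliffordPoly),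
      Submodule.span Cl3ᵐᵒᵖ (Set.range Y) = sphericalMonogenics k →
        ∀ᵐ η ∂(Measure.pi fun _ : Fin n => surfaceMeasure),
          IsUnit (gramMatrix (monogenicKernel Y) η)) ∧
    (∀ᵐ η ∂(Measure.pi fun _ : Fin n => surfaceMeasure),
      IsUnit (gramMatrix (closedFormKernel k) η)) := by
  refine ⟨fun d Y hY => ?_, ?_⟩
  · have hmem (l : Fin d) : Y l ∈ sphericalMonogenics k :=
      hY ▸ Submodule.subset_span (Set.mem_range_self l)
    exact ae_isUnit_kernelMatrix volume (weaklyAnalytic_monogenicKernel Y)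
      (monogenicKernel_smul hmem) (isUnit_kernelMatrix_monogenicKernel hn hY)
  · simp only [gramMatrix_closedFormKernel]
    exact ae_isUnit_kernelMatrix volume (weaklyAnalytic_homKernel k) (homKernel_smul k)
      (isUnit_kernelMatrix_homKernel hn)

/-- For almost every `(k+1)`-tuple of points of the sphere the Gram matrix of the reproducing kernel
of the spherical monogenics of order `k` is invertible, for the kernel built from any orthonormal
basis as well as for the kernel in closed form. -/
theorem mainTheorem4 (k : ℕ) :
    (∀ (d : ℕ) (Y : Fin d → CliffordPoly), IsMonogenicONB k Y →
      ∀ᵐ η ∂(Measure.pi fun _ : Fin (k + 1) => surfaceMeasure),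
        IsUnit (gramMatrix (monogenicKernel Y) η)) ∧
    (∀ᵐ η ∂(Measure.pi fun _ : Fin (k + 1) => surfaceMeasure),
      IsUnit (gramMatrix (closedFormKernel k) η)) :=
  (mainTheorem4_general le_rfl).imp_left fun h d Y hY => h d Y hY.span_eq
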